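/- For an $n\times n$ complex matrix $A$ let $W(A)=\{\langle Ax,x\rangle : x\in\mathbb C^n,\ \|x\|=1\}$ be its numerical range. Call a set $W\subset\mathbb C$ bi-elliptical if it is the convex hull $\operatorname{conv}(E_1\cup E_2)$ of two (non-degenerate) ellipses $E_1,E_2$ with distinct centers, neither of which is contained in the convex hull of the other. Let $\alpha=iv$ with $v\in\mathbb R$, $v\neq 0$, let $b_1,b_2\in\mathbb C$ and $b\in\mathbb R$, $b\ge 0$, put $\eta_j=\operatorname{Im} b_j$ for $j=1,2$, and let \[ A=\begin{bmatrix} \alpha & 0 & \overline{b_1}+1 & 0 \\ 0 & \alpha & b & \overline{b_2}+1 \\ b_1-1 & b & -\alpha & 0 \\ 0 & b_2-1 & 0 & -\alpha \end{bmatrix}. \] Then $W(A)$ is bi-elliptical if and only if $b\neq 0$, $|b_1|=|b_2|$, and $v^2b^2=(\eta_1-\eta_2)^2$. -/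

import Mathlib

/-- The numerical range of a square complex matrix: all values `⟨A x, x⟩ = x^* A x` over the
unit vectors `x` for the Euclidean norm. (Mathlib's inner product is conjugate-linear in its
first argument.) -/
def numericalRange {n : Type*} [Fintype n] (A : Matrix n n ℂ) : Set ℂ :=
  {w | ∃ x : EuclideanSpace ℂ n, ‖x‖ = 1 ∧ inner ℂ x (WithLp.toLp 2 (A.mulVec x)) = w}

/-- `E` is a (non-degenerate) ellipse in the complex plane with center `c`: for some rotation
angle `φ` and some semi-axes `r, s > 0` it is the curve `c + e^{iφ} (r cos t + i s sin t)`. -/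
def IsEllipse (E : Set ℂ) (c : ℂ) : Prop :=
  ∃ φ r s : ℝ, 0 < r ∧ 0 < s ∧
    E = Set.range fun t : ℝ => c + Complex.exp (φ * Complex.I) * ⟨r * Real.cos t, s * Real.sin t⟩

/-- A plane set is bi-elliptical if it is the convex hull of two ellipses with distinct centers.
Both ellipses have to matter: neither lies in the convex hull of the other. (Any
elliptical disk is the convex hull of its boundary together with a small off-center ellipse in
its interior, and this does not count.) -/
def IsBiElliptical (W : Set ℂ) : Prop :=
  ∃ (E₁ E₂ : Set ℂ) (c₁ c₂ : ℂ), IsEllipse E₁ c₁ ∧ IsEllipse E₂ c₂ ∧ c₁ ≠ c₂ ∧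
    ¬ E₁ ⊆ convexHull ℝ E₂ ∧ ¬ E₂ ⊆ convexHull ℝ E₁ ∧ W = convexHull ℝ (E₁ ∪ E₂)

/-- The matrix `[[α I, B^* + I], [B - I, -α I]]` with `B = [[b₁, b], [0, b₂]]` and `b` real. -/
def triangularizedMatrix (α b₁ b₂ : ℂ) (b : ℝ) : Matrix (Fin 4) (Fin 4) ℂ :=
  !![α,      0,      star b₁ + 1, 0;
     0,      α,      b,           star b₂ + 1;
     b₁ - 1, b,      -α,          0;
     0,      b₂ - 1, 0,           -α]

/-! A compact convex set is determined by its support function. In the direction (x, y) the support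
function of W(A) is the largest eigenvalue of a Hermitian matrix, hence a root of the Kippenhahn
polynomial F(x, y, t), which is even in t (`det_triangularizedMatrix`). For an ellipse the support
function is l + √Q, with l linear given by the center and Q a positive definite quadratic form; for
the hull of a union it is the maximum.

Necessity: of two distinct centers one is nonzero. Its ellipse is not inside the hull of the other,
so on an open set of directions its l + √Q is the support function of W(A), and F vanishes there. On
a line x = const ≠ 0 the polynomial Q in y is not a square, so the conjugate l − √Q is a root too.
As F is even and l ≠ 0, its coefficients are those with roots ±l ± √Q (`biquadratic_coeff_eq`).
Comparing coefficients in y makes the center real, and an inequality argument using (Im bⱼ)² ≤ |bⱼ|²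
(`eq_sq_of_coeff_identities`) forces it to be ±b/2, which yields the three conditions.

Sufficiency: under the conditions F factors into two quadratics in t belonging to translates of one
ellipse, centered at ±b/2 (`kippenhahnPoly_eq_mul`). The larger of their support functions is that
of W(A), which is convex by Toeplitz–Hausdorff. -/

/-! ### Linear functionals and convex hulls in the plane. -/

/-- The real linear functional `w ↦ x Re w + y Im w` on the complex plane. -/
noncomputable def planeFunctional (x y : ℝ) : ℂ →ₗ[ℝ] ℝ :=
  x • Complex.reLm + y • Complex.imLm

theorem planeFunctional_apply (x y : ℝ) (w : ℂ) :
    planeFunctional x y w = x * w.re + y * w.im := by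
  simp [planeFunctional]

theorem continuous_planeFunctional (x y : ℝ) : Continuous (planeFunctional x y) :=
  (planeFunctional x y).continuous_of_finiteDimensional

/-- A set lies in a closed convex set as soon as its values under every functional are dominated
by values on the closed convex set. -/
theorem subset_of_planeFunctional_le {S K : Set ℂ} (hconv : Convex ℝ K) (hcl : IsClosed K)
    (h : ∀ x y : ℝ, ∀ w ∈ S, ∃ k ∈ K, planeFunctional x y w ≤ planeFunctional x y k) :
    S ⊆ K := by
  intro w hw
  by_contra hwK
  obtain ⟨f, u, hf, hu⟩ := geometric_hahn_banach_closed_point hconv hcl hwK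
  have hfe : ∀ z : ℂ, f z = planeFunctional (f 1) (f Complex.I) z := by
    intro z
    have hz : z = z.re • (1 : ℂ) + z.im • Complex.I := by
      apply Complex.ext <;> simp
    rw [planeFunctional_apply]
    conv_lhs => rw [hz]
    rw [map_add, map_smul, map_smul, smul_eq_mul, smul_eq_mul]
    ring
  obtain ⟨k, hk, hle⟩ := h (f 1) (f Complex.I) w hw
  rw [← hfe, ← hfe] at hle
  linarith [hf k hk]

theorem IsGreatest.planeFunctional_convexHull {x y m : ℝ} {S : Set ℂ}
    (h : IsGreatest (planeFunctional x y '' S) m) :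
    IsGreatest (planeFunctional x y '' convexHull ℝ S) m := by
  refine ⟨Set.image_mono (subset_convexHull ℝ S) h.1, ?_⟩
  rintro _ ⟨w, hw, rfl⟩
  have hsub : convexHull ℝ S ⊆ {w | planeFunctional x y w ≤ m} :=
    convexHull_min (fun z hz => h.2 ⟨z, hz, rfl⟩)
      (convex_halfSpace_le (planeFunctional x y).isLinear m)
  exact hsub hw

theorem isCompact_convexHull_union {S T : Set ℂ} (hS : IsCompact (convexHull ℝ S))
    (hT : IsCompact (convexHull ℝ T)) (hS0 : S.Nonempty) (hT0 : T.Nonempty) :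
    IsCompact (convexHull ℝ (S ∪ T)) := by
  rw [convexHull_union hS0 hT0]
  have himg : convexJoin ℝ (convexHull ℝ S) (convexHull ℝ T) =
      (fun p : ℝ × ℂ × ℂ => (1 - p.1) • p.2.1 + p.1 • p.2.2) ''
        (Set.Icc (0 : ℝ) 1 ×ˢ (convexHull ℝ S) ×ˢ (convexHull ℝ T)) := by
    ext w
    simp only [mem_convexJoin, segment_eq_image, Set.mem_image, Set.mem_prod, Prod.exists]
    constructor
    · rintro ⟨a, ha, b, hb, t, ht, rfl⟩
      exact ⟨t, a, b, ⟨ht, ha, hb⟩, rfl⟩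
    · rintro ⟨t, a, b, ⟨ht, ha, hb⟩, rfl⟩
      exact ⟨a, ha, b, hb, t, ht, rfl⟩
  rw [himg]
  exact (isCompact_Icc.prod (hS.prod hT)).image (by fun_prop)

/-! ### Ellipses and their support functions. -/

theorem IsEllipse.nonempty {E : Set ℂ} {c : ℂ} (h : IsEllipse E c) : E.Nonempty := by
  obtain ⟨φ, r, s, -, -, rfl⟩ := h
  exact Set.range_nonempty _

/-- An ellipse is an affine image of the unit circle, so its hull is the same image of the closed
disk. -/
theorem IsEllipse.isCompact_convexHull {E : Set ℂ} {c : ℂ} (h : IsEllipse E c) :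
    IsCompact (convexHull ℝ E) := by
  obtain ⟨φ, r, s, -, -, rfl⟩ := h
  let g : ℂ →ₗ[ℝ] ℂ :=
    { toFun := fun z => Complex.exp (φ * Complex.I) * ⟨r * z.re, s * z.im⟩
      map_add' := fun z w => by
        rw [← mul_add]; congr 1; apply Complex.ext <;> simp [mul_add]
      map_smul' := fun a z => by
        simp only [RingHom.id_apply, Complex.real_smul]
        rw [mul_left_comm]; congr 1; apply Complex.ext <;> simp <;> ring }
  let f : ℂ →ᵃ[ℝ] ℂ := AffineMap.const ℝ ℂ c + g.toAffineMap
  have hf : ∀ z, f z = c + Complex.exp (φ * Complex.I) * ⟨r * z.re, s * z.im⟩ := fun z => rfl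
  have himg : (Set.range fun t : ℝ => c + Complex.exp (φ * Complex.I) *
      (⟨r * Real.cos t, s * Real.sin t⟩ : ℂ)) = f '' Metric.sphere (0 : ℂ) 1 := by
    ext w
    constructor
    · rintro ⟨t, rfl⟩
      refine ⟨Complex.exp (t * Complex.I), by simp, ?_⟩
      simp only [hf, Complex.exp_ofReal_mul_I_re, Complex.exp_ofReal_mul_I_im]
    · rintro ⟨z, hz, rfl⟩
      refine ⟨z.arg, ?_⟩
      have hz1 : ‖z‖ = 1 := by simpa using hz
      have hz0 : z ≠ 0 := by rintro rfl; simp at hz1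
      simp only [hf, Complex.cos_arg hz0, Complex.sin_arg, hz1, div_one]
  rw [himg, ← AffineMap.image_convexHull, convexHull_sphere_eq_closedBall _ zero_le_one]
  exact (isCompact_closedBall _ _).image f.continuous_of_finiteDimensional

theorem isGreatest_mul_cos_add_mul_sin (p q : ℝ) :
    IsGreatest (Set.range fun t : ℝ => p * Real.cos t + q * Real.sin t)
      (Real.sqrt (p ^ 2 + q ^ 2)) := by
  constructor
  · let z : ℂ := ⟨p, q⟩
    have hn : ‖z‖ = Real.sqrt (p ^ 2 + q ^ 2) := by
      rw [Complex.norm_eq_sqrt_sq_add_sq]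
    refine ⟨z.arg, ?_⟩
    have hc := Complex.norm_mul_cos_arg z
    have hs := Complex.norm_mul_sin_arg z
    have hcs := Real.cos_sq_add_sin_sq z.arg
    change ‖z‖ * Real.cos z.arg = p at hc
    change ‖z‖ * Real.sin z.arg = q at hs
    rw [← hn]
    change p * Real.cos z.arg + q * Real.sin z.arg = ‖z‖
    rw [← hc, ← hs]
    linear_combination ‖z‖ * hcs
  · rintro _ ⟨t, rfl⟩
    apply Real.le_sqrt_of_sq_le
    have hcs := Real.cos_sq_add_sin_sq t
    change (p * Real.cos t + q * Real.sin t) ^ 2 ≤ _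
    nlinarith [sq_nonneg (p * Real.sin t - q * Real.cos t)]

/-- The support function of an ellipse, in terms of its center, angle and semi-axes. -/
theorem isGreatest_planeFunctional_ellipse (c : ℂ) (φ r s x y : ℝ) :
    IsGreatest (planeFunctional x y '' Set.range fun t : ℝ =>
        c + Complex.exp (φ * Complex.I) * ⟨r * Real.cos t, s * Real.sin t⟩)
      (x * c.re + y * c.im + Real.sqrt ((r * (x * Real.cos φ + y * Real.sin φ)) ^ 2 +
        (s * (y * Real.cos φ - x * Real.sin φ)) ^ 2)) := by
  have hval : ∀ t : ℝ, planeFunctional x y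
      (c + Complex.exp (φ * Complex.I) * ⟨r * Real.cos t, s * Real.sin t⟩) =
      x * c.re + y * c.im + (r * (x * Real.cos φ + y * Real.sin φ) * Real.cos t +
        s * (y * Real.cos φ - x * Real.sin φ) * Real.sin t) := by
    intro t
    rw [planeFunctional_apply]
    simp only [Complex.add_re, Complex.add_im, Complex.mul_re, Complex.mul_im,
      Complex.exp_ofReal_mul_I_re, Complex.exp_ofReal_mul_I_im]
    ring
  obtain ⟨⟨t₀, ht₀⟩, hle⟩ := isGreatest_mul_cos_add_mul_sin
    (r * (x * Real.cos φ + y * Real.sin φ)) (s * (y * Real.cos φ - x * Real.sin φ))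
  constructor
  · refine ⟨_, ⟨t₀, rfl⟩, ?_⟩
    rw [hval, ← ht₀]
  · rintro _ ⟨_, ⟨t, rfl⟩, rfl⟩
    rw [hval]
    have := hle ⟨t, rfl⟩
    simpa using this

/-- The support function of an ellipse is a linear form plus the square root of a positive
definite quadratic form. -/
theorem IsEllipse.exists_support {E : Set ℂ} {c : ℂ} (h : IsEllipse E c) :
    ∃ a e d : ℝ, 0 < a ∧ 0 < d ∧ e ^ 2 < a * d ∧ ∀ x y : ℝ,
      IsGreatest (planeFunctional x y '' E)
        (x * c.re + y * c.im + Real.sqrt (a * x ^ 2 + 2 * e * x * y + d * y ^ 2)) := by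
  obtain ⟨φ, r, s, hr, hs, rfl⟩ := h
  have hcs := Real.cos_sq_add_sin_sq φ
  have hr2 : 0 < r ^ 2 := by positivity
  have hs2 : 0 < s ^ 2 := by positivity
  set C := Real.cos φ
  set S := Real.sin φ
  have key : ∀ p q : ℝ, 0 < p → 0 < q → 0 < p * C ^ 2 + q * S ^ 2 := by
    intro p q hp hq
    rcases eq_or_ne C 0 with h0 | h0
    · have : S ^ 2 = 1 := by rw [h0] at hcs; linarith
      rw [this]; nlinarith [sq_nonneg C]
    · have : 0 < C ^ 2 := by positivity
      positivity
  -- The entries of R diag(r², s²) Rᵀ with R the rotation by φ; its determinant is r²s².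
  refine ⟨r ^ 2 * C ^ 2 + s ^ 2 * S ^ 2, (r ^ 2 - s ^ 2) * C * S, s ^ 2 * C ^ 2 + r ^ 2 * S ^ 2,
    key _ _ hr2 hs2, key _ _ hs2 hr2, ?_, fun x y => ?_⟩
  · have : (r ^ 2 * C ^ 2 + s ^ 2 * S ^ 2) * (s ^ 2 * C ^ 2 + r ^ 2 * S ^ 2) -
        ((r ^ 2 - s ^ 2) * C * S) ^ 2 = r ^ 2 * s ^ 2 * (C ^ 2 + S ^ 2) ^ 2 := by ring
    rw [hcs] at this
    nlinarith [mul_pos hr2 hs2]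
  · convert isGreatest_planeFunctional_ellipse c φ r s x y using 3
    ring

/-- Every positive definite quadratic form arises from the support function of an ellipse with
prescribed center. -/
theorem exists_isEllipse_support (a e d : ℝ) (ha : 0 < a) (hd : e ^ 2 < a * d) :
    ∃ S : ℂ → Set ℂ, ∀ c, IsEllipse (S c) c ∧ ∀ x y : ℝ,
      IsGreatest (planeFunctional x y '' S c)
        (x * c.re + y * c.im + Real.sqrt (a * x ^ 2 + 2 * e * x * y + d * y ^ 2)) := by
  have hd0 : 0 < d := by
    by_contra! h
    nlinarith [sq_nonneg e]
  -- The symmetric matrix with entries a, e, d has eigenvalues (a + d)/2 ± |z|, the squared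
  -- semi-axes; its principal axis has angle arg z / 2.
  let z : ℂ := ⟨(a - d) / 2, e⟩
  have hzn : ‖z‖ ^ 2 = ((a - d) / 2) ^ 2 + e ^ 2 := by
    rw [Complex.norm_eq_sqrt_sq_add_sq, Real.sq_sqrt (by positivity)]
  have hzlt : ‖z‖ < (a + d) / 2 := by
    apply lt_of_pow_lt_pow_left₀ 2 (by positivity)
    rw [hzn]; nlinarith
  have hz0 : 0 ≤ ‖z‖ := norm_nonneg z
  have hc : ‖z‖ * Real.cos z.arg = (a - d) / 2 := Complex.norm_mul_cos_arg z
  have hs : ‖z‖ * Real.sin z.arg = e := Complex.norm_mul_sin_arg z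
  set φ := z.arg / 2 with hφ
  have h2 : z.arg = 2 * φ := by rw [hφ]; ring
  rw [h2, Real.cos_two_mul] at hc
  rw [h2, Real.sin_two_mul] at hs
  have hcs := Real.cos_sq_add_sin_sq φ
  have hr : 0 < (a + d) / 2 + ‖z‖ := by linarith
  have hs' : 0 < (a + d) / 2 - ‖z‖ := by linarith
  refine ⟨fun c => Set.range fun t : ℝ => c + Complex.exp (φ * Complex.I) *
    ⟨Real.sqrt ((a + d) / 2 + ‖z‖) * Real.cos t, Real.sqrt ((a + d) / 2 - ‖z‖) * Real.sin t⟩,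
    fun c => ⟨⟨φ, _, _, Real.sqrt_pos.2 hr, Real.sqrt_pos.2 hs', rfl⟩, fun x y => ?_⟩⟩
  convert isGreatest_planeFunctional_ellipse c φ _ _ x y using 3
  rw [mul_pow, mul_pow, Real.sq_sqrt hr.le, Real.sq_sqrt hs'.le]
  generalize Real.cos φ = C at *
  generalize Real.sin φ = S at *
  linear_combination (-(x ^ 2 - y ^ 2)) * hc - 2 * x * y * hs
    - ((a + d) / 2 * (x ^ 2 + y ^ 2) - ‖z‖ * (x ^ 2 - y ^ 2)) * hcs

/-! ### The Toeplitz–Hausdorff theorem. -/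

open scoped InnerProductSpace in
/-- A unit vector realizing any value between two values `0` and `1` of a quadratic form. -/
theorem exists_unit_inner_apply_eq {E : Type*} [NormedAddCommGroup E] [InnerProductSpace ℂ E]
    (S : E →L[ℂ] E) {x y : E} (hx : ‖x‖ = 1) (hy : ‖y‖ = 1) (hSx : ⟪x, S x⟫_ℂ = 0)
    (hSy : ⟪y, S y⟫_ℂ = 1) {τ : ℝ} (hτ : τ ∈ Set.Icc (0 : ℝ) 1) :
    ∃ u : E, ‖u‖ = 1 ∧ ⟪u, S u⟫_ℂ = τ := by
  -- Rotating x by a phase z makes the cross terms sum to a real number, so the form stays real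
  -- along the segment from z • x to y and the intermediate value theorem applies.
  obtain ⟨z, hz, hzim⟩ : ∃ z : ℂ, ‖z‖ = 1 ∧
      (z * (⟪y, S x⟫_ℂ - star ⟪x, S y⟫_ℂ)).im = 0 := by
    generalize ⟪y, S x⟫_ℂ - star ⟪x, S y⟫_ℂ = u
    rcases eq_or_ne u 0 with rfl | hu
    · exact ⟨1, by simp, by simp⟩
    · refine ⟨star u / ‖u‖, ?_, ?_⟩
      · simp [hu]
      · rw [div_mul_eq_mul_div, Complex.star_def,
          ← Complex.normSq_eq_conj_mul_self, ← Complex.ofReal_div, Complex.ofReal_im]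
  obtain ⟨κ, hκ⟩ : ∃ κ : ℝ, star z * ⟪x, S y⟫_ℂ + z * ⟪y, S x⟫_ℂ = κ := by
    refine ⟨(star z * ⟪x, S y⟫_ℂ + z * ⟪y, S x⟫_ℂ).re, ?_⟩
    apply Complex.ext
    · simp
    · rw [Complex.ofReal_im, ← hzim]
      simp only [Complex.add_im, Complex.mul_im, Complex.sub_im, Complex.sub_re,
        Complex.star_def, Complex.conj_re, Complex.conj_im]
      ring
  let v : ℝ → E := fun t => ((1 - t : ℝ) : ℂ) • z • x + (t : ℂ) • y
  have hv : ∀ t, ⟪v t, S (v t)⟫_ℂ = ((t * (1 - t) * κ + t ^ 2 : ℝ) : ℂ) := by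
    intro t
    simp only [v, map_add, map_smul, inner_add_left, inner_add_right, inner_smul_left,
      inner_smul_right, hSx, hSy, Complex.conj_ofReal]
    push_cast
    rw [← hκ]
    simp only [Complex.star_def]
    ring
  have hv0 : ∀ t ∈ Set.Icc (0 : ℝ) 1, v t ≠ 0 := by
    intro t ht h0
    have h1 : ((1 - t : ℝ) : ℂ) • z • x = -((t : ℂ) • y) := eq_neg_of_add_eq_zero_left h0
    have h2 := congrArg norm h1
    rw [norm_neg, norm_smul, norm_smul, norm_smul, hz, hx, hy, Complex.norm_real,
      Complex.norm_real, Real.norm_of_nonneg ht.1, Real.norm_of_nonneg (by linarith [ht.2])] at h2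
    have ht2 : t = 1 / 2 := by linarith
    have h3 : z • x = -y := by
      rw [ht2, ← smul_neg] at h1
      have : (((1 - 1 / 2 : ℝ)) : ℂ) = ((1 / 2 : ℝ) : ℂ) := by norm_num
      rw [this] at h1
      exact smul_right_injective E (by norm_num) h1
    have h4 : ⟪z • x, S (z • x)⟫_ℂ = 0 := by
      rw [map_smul, inner_smul_left, inner_smul_right, hSx, mul_zero, mul_zero]
    rw [h3, map_neg, inner_neg_neg, hSy] at h4
    exact one_ne_zero h4
  have hcont : Continuous v := by fun_prop
  have hg : ContinuousOn (fun t => (t * (1 - t) * κ + t ^ 2) / ‖v t‖ ^ 2) (Set.Icc (0 : ℝ) 1) := by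
    apply ContinuousOn.div
    · fun_prop
    · fun_prop
    · intro t ht
      have := norm_pos_iff.2 (hv0 t ht)
      positivity
  have hivt := intermediate_value_Icc (zero_le_one) hg
  have hv1 : v 1 = y := by simp [v]
  obtain ⟨t, ht, hgt⟩ := hivt (by simpa [hv1, hy] using hτ)
  have hn : 0 < ‖v t‖ := norm_pos_iff.2 (hv0 t ht)
  refine ⟨((‖v t‖⁻¹ : ℝ) : ℂ) • v t, ?_, ?_⟩
  · rw [norm_smul, Complex.norm_real, norm_inv, norm_norm, inv_mul_cancel₀ hn.ne']
  · rw [map_smul, inner_smul_left, inner_smul_right, hv, Complex.conj_ofReal]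
    rw [← Complex.ofReal_mul, ← Complex.ofReal_mul, ← hgt]
    congr 1
    field_simp

open scoped InnerProductSpace in
/-- The Toeplitz–Hausdorff theorem: the numerical range of an operator is convex. -/
theorem convex_setOf_inner_apply {E : Type*} [NormedAddCommGroup E] [InnerProductSpace ℂ E]
    (T : E →L[ℂ] E) : Convex ℝ {w : ℂ | ∃ x : E, ‖x‖ = 1 ∧ ⟪x, T x⟫_ℂ = w} := by
  rw [convex_iff_segment_subset]
  rintro a ⟨x, hx, hxa⟩ b ⟨y, hy, hyb⟩
  rw [segment_eq_image']
  rintro _ ⟨τ, hτ, rfl⟩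
  rcases eq_or_ne a b with rfl | hab
  · exact ⟨x, hx, by simp [hxa]⟩
  have hba : b - a ≠ 0 := sub_ne_zero.2 hab.symm
  -- An affine change of T moves the values a, b to 0, 1.
  have hS : ∀ u : E, ‖u‖ = 1 →
      ⟪u, ((b - a)⁻¹ • (T - a • ContinuousLinearMap.id ℂ E)) u⟫_ℂ =
        (b - a)⁻¹ * (⟪u, T u⟫_ℂ - a) := by
    intro u hu
    simp [inner_self_eq_norm_sq_to_K, hu]
  obtain ⟨u, hu, hSu⟩ := exists_unit_inner_apply_eq
    ((b - a)⁻¹ • (T - a • ContinuousLinearMap.id ℂ E)) hx hy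
    (by rw [hS x hx, hxa, sub_self, mul_zero])
    (by rw [hS y hy, hyb, inv_mul_cancel₀ hba]) hτ
  refine ⟨u, hu, ?_⟩
  rw [hS u hu, inv_mul_eq_iff_eq_mul₀ hba] at hSu
  simp only [Complex.real_smul]
  linear_combination hSu

/-! ### Support values of the numerical range as eigenvalues. -/

section NumericalRange

variable {n : Type*} [Fintype n]

theorem numericalRange_eq_setOf [DecidableEq n] (A : Matrix n n ℂ) :
    numericalRange A = {w : ℂ | ∃ x : EuclideanSpace ℂ n, ‖x‖ = 1 ∧
      inner ℂ x (Matrix.toEuclideanCLM (𝕜 := ℂ) A x) = w} := rfl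

theorem convex_numericalRange (A : Matrix n n ℂ) : Convex ℝ (numericalRange A) := by
  classical
  rw [numericalRange_eq_setOf]
  exact convex_setOf_inner_apply _

theorem isCompact_numericalRange (A : Matrix n n ℂ) : IsCompact (numericalRange A) := by
  classical
  have : numericalRange A = (fun x : EuclideanSpace ℂ n =>
      inner ℂ x (Matrix.toEuclideanCLM (𝕜 := ℂ) A x)) '' Metric.sphere 0 1 := by
    rw [numericalRange_eq_setOf]
    ext w
    simp
  rw [this]
  exact (isCompact_sphere _ _).image (by fun_prop)

theorem nonempty_numericalRange [Nonempty n] (A : Matrix n n ℂ) :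
    (numericalRange A).Nonempty := by
  obtain ⟨x, hx⟩ := exists_norm_eq (EuclideanSpace ℂ n) zero_le_one
  exact ⟨_, x, hx, rfl⟩

/-- The Hermitian matrix whose quadratic form is the functional `w ↦ x Re w + y Im w` of the
quadratic form of `A`. -/
noncomputable def hermitianCombination {n : Type*} (A : Matrix n n ℂ) (x y : ℝ) : Matrix n n ℂ :=
  ((x - y * Complex.I) / 2) • A + ((x + y * Complex.I) / 2) • A.conjTranspose

theorem isHermitian_hermitianCombination {n : Type*} (A : Matrix n n ℂ) (x y : ℝ) :
    (hermitianCombination A x y).IsHermitian := by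
  rw [Matrix.IsHermitian, hermitianCombination, Matrix.conjTranspose_add,
    Matrix.conjTranspose_smul, Matrix.conjTranspose_smul, Matrix.conjTranspose_conjTranspose,
    add_comm]
  congr 2 <;> simp [sub_eq_add_neg]

theorem star_dotProduct_hermitianCombination_mulVec (A : Matrix n n ℂ) (x y : ℝ) (ξ : n → ℂ) :
    star ξ ⬝ᵥ (hermitianCombination A x y).mulVec ξ =
      (planeFunctional x y (star ξ ⬝ᵥ A.mulVec ξ) : ℂ) := by
  have hstar : star ξ ⬝ᵥ A.conjTranspose.mulVec ξ = star (star ξ ⬝ᵥ A.mulVec ξ) := by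
    rw [Matrix.star_dotProduct, Matrix.star_mulVec, Matrix.conjTranspose_conjTranspose,
      Matrix.dotProduct_mulVec]
  rw [hermitianCombination, Matrix.add_mulVec, Matrix.smul_mulVec, Matrix.smul_mulVec,
    dotProduct_add, dotProduct_smul, dotProduct_smul, hstar, planeFunctional_apply]
  apply Complex.ext <;> simp <;> ring

theorem star_dotProduct_mulVec_mem_numericalRange (A : Matrix n n ℂ)
    {x : EuclideanSpace ℂ n} (hx : ‖x‖ = 1) :
    star x.ofLp ⬝ᵥ A.mulVec x.ofLp ∈ numericalRange A :=
  ⟨x, hx, by rw [EuclideanSpace.inner_eq_star_dotProduct, dotProduct_comm]⟩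

theorem star_dotProduct_self (x : EuclideanSpace ℂ n) :
    star x.ofLp ⬝ᵥ x.ofLp = ((‖x‖ ^ 2 : ℝ) : ℂ) := by
  rw [dotProduct_comm, ← EuclideanSpace.inner_eq_star_dotProduct, inner_self_eq_norm_sq_to_K]
  simp

theorem exists_mem_numericalRange_of_ne_zero (A : Matrix n n ℂ) (x : n → ℂ) (hx : x ≠ 0) :
    ∃ w ∈ numericalRange A, ∃ r : ℝ, 0 < r ∧ star x ⬝ᵥ x = r ∧
      star x ⬝ᵥ A.mulVec x = r * w := by
  let ξ : EuclideanSpace ℂ n := WithLp.toLp 2 x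
  have hξ : 0 < ‖ξ‖ := norm_pos_iff.2 (by simpa [ξ] using hx)
  have hu : ‖((‖ξ‖⁻¹ : ℝ) : ℂ) • ξ‖ = 1 := by
    rw [norm_smul, Complex.norm_real, norm_inv, norm_norm, inv_mul_cancel₀ hξ.ne']
  refine ⟨_, star_dotProduct_mulVec_mem_numericalRange A hu, ‖ξ‖ ^ 2, by positivity,
    star_dotProduct_self ξ, ?_⟩
  have : (‖ξ‖ : ℂ) ≠ 0 := by exact_mod_cast hξ.ne'
  rw [WithLp.ofLp_smul, star_smul, Matrix.mulVec_smul, smul_dotProduct, dotProduct_smul]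
  simp only [smul_eq_mul, Complex.star_def, Complex.conj_ofReal]
  push_cast
  field_simp
  rfl

open scoped ComplexOrder in
/-- The greatest value of a linear functional on the numerical range is an eigenvalue. -/
theorem det_eq_zero_of_isGreatest [DecidableEq n] (A : Matrix n n ℂ) {x y m : ℝ}
    (h : IsGreatest (planeFunctional x y '' numericalRange A) m) :
    ((m : ℂ) • (1 : Matrix n n ℂ) - hermitianCombination A x y).det = 0 := by
  set M := (m : ℂ) • (1 : Matrix n n ℂ) - hermitianCombination A x y with hM
  have hMv : ∀ ξ : n → ℂ, star ξ ⬝ᵥ M.mulVec ξ =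
      m * (star ξ ⬝ᵥ ξ) - (planeFunctional x y (star ξ ⬝ᵥ A.mulVec ξ) : ℂ) := by
    intro ξ
    rw [hM, Matrix.sub_mulVec, dotProduct_sub, Matrix.smul_mulVec, Matrix.one_mulVec,
      dotProduct_smul, star_dotProduct_hermitianCombination_mulVec, smul_eq_mul]
  have hherm : M.IsHermitian := by
    refine Matrix.IsHermitian.sub ?_ (isHermitian_hermitianCombination A x y)
    rw [Matrix.IsHermitian, Matrix.conjTranspose_smul]
    simp
  -- For a positive semidefinite matrix a zero of the quadratic form lies in the kernel; a maximizer
  -- is such a zero.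
  have hpsd : M.PosSemidef := by
    refine Matrix.PosSemidef.of_dotProduct_mulVec_nonneg hherm fun ξ => ?_
    rcases eq_or_ne ξ 0 with rfl | hξ
    · simp
    obtain ⟨w, hw, r, hr, hr1, hr2⟩ := exists_mem_numericalRange_of_ne_zero A ξ hξ
    have hle : planeFunctional x y w ≤ m := h.2 ⟨w, hw, rfl⟩
    rw [hMv, hr1, hr2, ← Complex.real_smul (z := w), map_smul, smul_eq_mul]
    have : 0 ≤ m * r - r * planeFunctional x y w := by nlinarith
    exact_mod_cast this
  obtain ⟨_, ⟨ξ, hξ, rfl⟩, hval⟩ := h.1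
  rw [EuclideanSpace.inner_eq_star_dotProduct, dotProduct_comm] at hval
  refine Matrix.exists_mulVec_eq_zero_iff.1 ⟨ξ.ofLp, ?_, ?_⟩
  · rintro h0
    have : ξ = 0 := by
      ext i; exact congrFun h0 i
    simp [this] at hξ
  · rw [← hpsd.dotProduct_mulVec_zero_iff, hMv, star_dotProduct_self, hξ]
    simp [hval]

/-- Every real eigenvalue of the Hermitian combination is a value of the functional on the
numerical range. -/
theorem exists_planeFunctional_eq_of_det_eq_zero [DecidableEq n] (A : Matrix n n ℂ) {x y t : ℝ}
    (h : ((t : ℂ) • (1 : Matrix n n ℂ) - hermitianCombination A x y).det = 0) :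
    ∃ w ∈ numericalRange A, planeFunctional x y w = t := by
  obtain ⟨ξ, hξ, hM⟩ := Matrix.exists_mulVec_eq_zero_iff.2 h
  obtain ⟨w, hw, r, hr, hr1, hr2⟩ := exists_mem_numericalRange_of_ne_zero A ξ hξ
  refine ⟨w, hw, ?_⟩
  have h0 : star ξ ⬝ᵥ ((t : ℂ) • (1 : Matrix n n ℂ) - hermitianCombination A x y).mulVec ξ = 0 := by
    rw [hM, dotProduct_zero]
  rw [Matrix.sub_mulVec, dotProduct_sub, Matrix.smul_mulVec, Matrix.one_mulVec,
    dotProduct_smul, star_dotProduct_hermitianCombination_mulVec, smul_eq_mul, hr1, hr2,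
    ← Complex.real_smul (z := w), map_smul, smul_eq_mul] at h0
  have h1 : t * r - r * planeFunctional x y w = 0 := by exact_mod_cast h0
  have : r * (t - planeFunctional x y w) = 0 := by linarith
  rcases mul_eq_zero.1 this with h | h <;> linarith

end NumericalRange

/-! ### The Kippenhahn polynomial. -/

/-- `‖b‖ ^ 2 x ^ 2 + 2 x y Im b + y ^ 2 = |x b + i y| ^ 2`. -/
def diagonalForm (b : ℂ) (x y : ℝ) : ℝ :=
  Complex.normSq b * x ^ 2 + 2 * b.im * x * y + y ^ 2

/-- The Kippenhahn polynomial of `triangularizedMatrix (v * I) b₁ b₂ b`. -/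
def kippenhahnPoly (v : ℝ) (b₁ b₂ : ℂ) (b x y t : ℝ) : ℝ :=
  (t ^ 2 - v ^ 2 * y ^ 2) ^ 2 -
    (diagonalForm b₁ x y + diagonalForm b₂ x y + b ^ 2 * x ^ 2) * (t ^ 2 - v ^ 2 * y ^ 2) +
    diagonalForm b₁ x y * diagonalForm b₂ x y

/-- The diagonal blocks are the scalars t ∓ vy and the off-diagonal ones are −M*, −M with M = xB +
iyI. So the determinant is the characteristic polynomial of M*M at t² − v²y², with trace and
determinant read off from the triangular M. -/
theorem det_triangularizedMatrix (v : ℝ) (b₁ b₂ : ℂ) (b x y t : ℝ) :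
    ((t : ℂ) • (1 : Matrix (Fin 4) (Fin 4) ℂ) -
      hermitianCombination (triangularizedMatrix (v * Complex.I) b₁ b₂ b) x y).det =
      (kippenhahnPoly v b₁ b₂ b x y t : ℂ) := by
  have hM : (t : ℂ) • (1 : Matrix (Fin 4) (Fin 4) ℂ) -
      hermitianCombination (triangularizedMatrix (v * Complex.I) b₁ b₂ b) x y =
      !![(t - y * v : ℂ), 0, -(x * star b₁ - y * Complex.I), 0;
         0, t - y * v, -(x * b), -(x * star b₂ - y * Complex.I);
         -(x * b₁ + y * Complex.I), -(x * b), t + y * v, 0;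
         0, -(x * b₂ + y * Complex.I), 0, t + y * v] := by
    ext i j
    fin_cases i <;> fin_cases j <;> apply Complex.ext <;>
      simp [hermitianCombination, triangularizedMatrix, Matrix.conjTranspose_apply] <;> ring
  rw [hM]
  simp only [Matrix.det_succ_row_zero, Fin.sum_univ_succ]
  obtain ⟨β₁, η₁⟩ := b₁
  obtain ⟨β₂, η₂⟩ := b₂
  simp [Fin.succAbove]
  apply Complex.ext
  · rw [Complex.ofReal_re]
    simp [kippenhahnPoly, diagonalForm, Complex.normSq_mk]
    ring
  · rw [Complex.ofReal_im]
    simp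
    ring

/-! ### From one root l + √Q to all four. -/

open Polynomial in
/-- A quadratic polynomial without real roots is not the square of a quotient of polynomials. -/
theorem eq_zero_of_sq_eq_sq_mul {G₀ G₁ Q : ℝ[X]} (hdeg : Q.natDegree = 2)
    (hpos : ∀ z, 0 < Q.eval z) (h : G₀ ^ 2 = G₁ ^ 2 * Q) : G₁ = 0 := by
  by_contra hG
  obtain ⟨g, rfl⟩ := (IsIntegrallyClosed.pow_dvd_pow_iff two_ne_zero).1 ⟨Q, h⟩
  rw [mul_pow] at h
  have hg : g ^ 2 = Q := mul_left_cancel₀ (pow_ne_zero 2 hG) h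
  have hg1 : g.natDegree = 1 := by
    have := congrArg natDegree hg
    rw [natDegree_pow, hdeg] at this
    omega
  obtain ⟨z, hz⟩ := exists_root_of_degree_eq_one
    ((degree_eq_iff_natDegree_eq_of_pos one_pos).2 hg1)
  have := hpos z
  rw [← hg, eval_pow, hz.eq_zero] at this
  norm_num at this

open Polynomial in
/-- If `l + √Q` is a root of the biquadratic `t ^ 4 - P t ^ 2 + N` for infinitely many parameter
values, then so are all of `±l ± √Q`. -/
theorem biquadratic_coeff_eq {l Q P N : ℝ[X]} (hl : l ≠ 0) (hdeg : Q.natDegree = 2)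
    (hpos : ∀ z, 0 < Q.eval z)
    (h : {z : ℝ | ((l.eval z + Real.sqrt (Q.eval z)) ^ 2) ^ 2 -
      P.eval z * (l.eval z + Real.sqrt (Q.eval z)) ^ 2 + N.eval z = 0}.Infinite) :
    P = 2 * (l ^ 2 + Q) ∧ N = (l ^ 2 - Q) ^ 2 := by
  -- G₀ + G₁√Q is the biquadratic evaluated at l + √Q.
  set G₀ : ℝ[X] := (l ^ 2 + Q) ^ 2 + 4 * l ^ 2 * Q - P * (l ^ 2 + Q) + N with hG₀
  set G₁ : ℝ[X] := 2 * l * (2 * (l ^ 2 + Q) - P) with hG₁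
  have hroot : ∀ z, ((l.eval z + Real.sqrt (Q.eval z)) ^ 2) ^ 2 -
      P.eval z * (l.eval z + Real.sqrt (Q.eval z)) ^ 2 + N.eval z = 0 →
      G₀.eval z + G₁.eval z * Real.sqrt (Q.eval z) = 0 := by
    intro z hz
    have hs := Real.sq_sqrt (hpos z).le
    simp only [hG₀, hG₁, eval_add, eval_sub, eval_mul, eval_pow, eval_ofNat]
    generalize Real.sqrt (Q.eval z) = s at *
    rw [← hs]
    linear_combination hz
  -- Multiplying by the conjugate G₀ − G₁√Q removes the root; infinitely many zeros then give a
  -- polynomial identity.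
  have hsq : G₀ ^ 2 = G₁ ^ 2 * Q := by
    refine eq_of_infinite_eval_eq _ _ (h.mono fun z hz => ?_)
    have h1 := hroot z hz
    have hs := Real.sq_sqrt (hpos z).le
    simp only [Set.mem_ofPred_eq, eval_mul, eval_pow]
    linear_combination (G₀.eval z - G₁.eval z * Real.sqrt (Q.eval z)) * h1 +
      (G₁.eval z) ^ 2 * hs
  have hG₁0 : G₁ = 0 := eq_zero_of_sq_eq_sq_mul hdeg hpos hsq
  have hG₀0 : G₀ = 0 := by
    rw [hG₁0] at hsq
    simpa using hsq
  have hP : P = 2 * (l ^ 2 + Q) := by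
    have h2l : (2 : ℝ[X]) * l ≠ 0 := mul_ne_zero two_ne_zero hl
    have := (mul_eq_zero.1 (hG₁.symm.trans hG₁0)).resolve_left h2l
    linear_combination -this
  refine ⟨hP, ?_⟩
  rw [hP] at hG₀
  linear_combination hG₀0 - hG₀

theorem quadraticForm_pos {a e d x z : ℝ} (hd : 0 < d) (hdisc : e ^ 2 < a * d) (hx : x ≠ 0) :
    0 < a * x ^ 2 + 2 * e * x * z + d * z ^ 2 := by
  have hx2 : 0 < x ^ 2 := by positivity
  have h : 0 < d * (a * x ^ 2 + 2 * e * x * z + d * z ^ 2) := by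
    nlinarith [sq_nonneg (d * z + e * x)]
  exact pos_of_mul_pos_right h hd.le

open Polynomial in
/-- If a non-centered ellipse contributes to the support function of the numerical range on an
interval, then its center is real and the Kippenhahn polynomial splits accordingly. -/
theorem splitting_of_infinite_roots {v b : ℝ} {b₁ b₂ : ℂ} {p q a e d x : ℝ} (hx : x ≠ 0)
    (hc : p ≠ 0 ∨ q ≠ 0) (hd : 0 < d) (hdisc : e ^ 2 < a * d)
    (h : {z : ℝ | kippenhahnPoly v b₁ b₂ b x z
      (x * p + z * q + Real.sqrt (a * x ^ 2 + 2 * e * x * z + d * z ^ 2)) = 0}.Infinite) :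
    (∀ z : ℝ, diagonalForm b₁ x z + diagonalForm b₂ x z + b ^ 2 * x ^ 2 + 2 * v ^ 2 * z ^ 2 =
      2 * ((x * p + z * q) ^ 2 + (a * x ^ 2 + 2 * e * x * z + d * z ^ 2))) ∧
    (∀ z : ℝ, (diagonalForm b₁ x z + diagonalForm b₂ x z + b ^ 2 * x ^ 2) ^ 2 -
      4 * (diagonalForm b₁ x z * diagonalForm b₂ x z) =
      16 * (x * p + z * q) ^ 2 * (a * x ^ 2 + 2 * e * x * z + d * z ^ 2)) := by
  let l : ℝ[X] := C (x * p) + C q * X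
  let Q : ℝ[X] := C d * X ^ 2 + C (2 * e * x) * X + C (a * x ^ 2)
  let D : ℂ → ℝ[X] := fun β => C (Complex.normSq β * x ^ 2) + C (2 * β.im * x) * X + X ^ 2
  let T : ℝ[X] := D b₁ + D b₂ + C (b ^ 2 * x ^ 2)
  let P : ℝ[X] := T + C (2 * v ^ 2) * X ^ 2
  let N : ℝ[X] := C (v ^ 4) * X ^ 4 + T * (C (v ^ 2) * X ^ 2) + D b₁ * D b₂
  have hlz : ∀ z, l.eval z = x * p + z * q := fun z => by simp [l]; ring
  have hQz : ∀ z, Q.eval z = a * x ^ 2 + 2 * e * x * z + d * z ^ 2 := fun z => by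
    simp [Q]; ring
  have hDz : ∀ β z, (D β).eval z = diagonalForm β x z := fun β z => by
    simp [D, diagonalForm]
  have hTz : ∀ z, T.eval z = diagonalForm b₁ x z + diagonalForm b₂ x z + b ^ 2 * x ^ 2 :=
    fun z => by simp only [T, eval_add, eval_C, hDz]
  have hPz : ∀ z, P.eval z = diagonalForm b₁ x z + diagonalForm b₂ x z + b ^ 2 * x ^ 2 +
      2 * v ^ 2 * z ^ 2 := fun z => by
    simp only [P, eval_add, eval_mul, eval_C, eval_pow, eval_X, hTz]
  have hNz : ∀ z, N.eval z = v ^ 4 * z ^ 4 + (diagonalForm b₁ x z + diagonalForm b₂ x z +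
      b ^ 2 * x ^ 2) * (v ^ 2 * z ^ 2) + diagonalForm b₁ x z * diagonalForm b₂ x z := fun z => by
    simp only [N, eval_add, eval_mul, eval_C, eval_pow, eval_X, hTz, hDz]
  have hl : l ≠ 0 := by
    intro h0
    have h1 := hlz 0
    have h2 := hlz 1
    rw [h0, eval_zero] at h1 h2
    have hp : p = 0 := by
      have : x * p = 0 := by linarith
      exact (mul_eq_zero.1 this).resolve_left hx
    have hq : q = 0 := by rw [hp] at h2; linarith
    rcases hc with hc | hc <;> contradiction
  have hdeg : Q.natDegree = 2 := natDegree_quadratic hd.ne'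
  have hpos : ∀ z, 0 < Q.eval z := fun z => by
    rw [hQz]; exact quadraticForm_pos hd hdisc hx
  obtain ⟨hP, hN⟩ := biquadratic_coeff_eq (P := P) (N := N) hl hdeg hpos (h.mono fun z hz => by
    simp only [Set.mem_ofPred_eq, kippenhahnPoly] at hz ⊢
    rw [hlz, hQz, hPz, hNz]
    linear_combination hz)
  have hP' : ∀ z : ℝ, diagonalForm b₁ x z + diagonalForm b₂ x z + b ^ 2 * x ^ 2 +
      2 * v ^ 2 * z ^ 2 =
      2 * ((x * p + z * q) ^ 2 + (a * x ^ 2 + 2 * e * x * z + d * z ^ 2)) := fun z => by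
    rw [← hPz, hP, eval_mul, eval_add, eval_pow, hlz, hQz, eval_ofNat]
  refine ⟨hP', fun z => ?_⟩
  have hN' : N.eval z =
      ((x * p + z * q) ^ 2 - (a * x ^ 2 + 2 * e * x * z + d * z ^ 2)) ^ 2 := by
    rw [hN, eval_pow, eval_sub, eval_pow, hlz, hQz]
  rw [hNz] at hN'
  -- This is P² − 4N = 16 l²Q: the shift of t² by v²z² does not change the discriminant.
  linear_combination (diagonalForm b₁ x z + diagonalForm b₂ x z + b ^ 2 * x ^ 2 +
      2 * v ^ 2 * z ^ 2 + 2 * ((x * p + z * q) ^ 2 + (a * x ^ 2 + 2 * e * x * z + d * z ^ 2))) *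
      hP' z - 4 * hN'

/-! ### Comparing coefficients. -/

/-- Put m = K − b², D = (η₁ − η₂)², s = (η₁ + η₂)², N = n₁ + n₂. By `hxx` and N ≥ 0, m < 0 is
impossible. If m > 0, squaring `hxy` and using `hxx` gives ms = (2N − m)D, while s + D ≤ 2N by `h₁`
and `h₂`; hence (D − m)(s + D) ≤ 0. But D = m + Kv² > m because v ≠ 0. -/
theorem eq_sq_of_coeff_identities {v b K n₁ n₂ η₁ η₂ : ℝ} (hv : v ≠ 0) (hK : 0 < K)
    (h₁ : η₁ ^ 2 ≤ n₁) (h₂ : η₂ ^ 2 ≤ n₂)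
    (hyy : (η₁ - η₂) ^ 2 + b ^ 2 = K * (1 + v ^ 2))
    (hxy : (n₁ - n₂) * (η₁ - η₂) = (K - b ^ 2) * (η₁ + η₂))
    (hxx : (n₁ - n₂) ^ 2 = 2 * (n₁ + n₂) * (K - b ^ 2) - (K - b ^ 2) ^ 2) :
    K = b ^ 2 := by
  by_contra hne
  have hv2 : 0 < v ^ 2 := by positivity
  obtain ⟨m, hm⟩ : ∃ m, m = K - b ^ 2 := ⟨_, rfl⟩
  have hm0 : m ≠ 0 := by rw [hm]; exact sub_ne_zero.2 hne
  rw [← hm] at hxy hxx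
  have hδ : (η₁ - η₂) ^ 2 = m + K * v ^ 2 := by rw [hm]; linarith
  have hS : (η₁ + η₂) ^ 2 + (η₁ - η₂) ^ 2 ≤ 2 * (n₁ + n₂) := by nlinarith
  have hKv : 0 < K * v ^ 2 := by positivity
  have hprod : 0 ≤ m * (2 * (n₁ + n₂) - m) := by nlinarith [sq_nonneg (n₁ - n₂)]
  have hmpos : 0 < m := by
    by_contra! hle
    have hlt : m < 0 := lt_of_le_of_ne hle hm0
    nlinarith [sq_nonneg (η₁ + η₂), sq_nonneg (η₁ - η₂)]
  have hcancel : m * (η₁ + η₂) ^ 2 = (2 * (n₁ + n₂) - m) * (η₁ - η₂) ^ 2 := by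
    apply mul_left_cancel₀ hm0
    linear_combination (-(n₁ - n₂) * (η₁ - η₂) - m * (η₁ + η₂)) * hxy + (η₁ - η₂) ^ 2 * hxx
  have hgt : m < (η₁ - η₂) ^ 2 := by linarith
  generalize (η₁ - η₂) ^ 2 = D at *
  have hσ : 0 ≤ (η₁ + η₂) ^ 2 := sq_nonneg _
  generalize (η₁ + η₂) ^ 2 = s at *
  nlinarith [mul_le_mul_of_nonneg_right hS (by linarith : 0 ≤ D),
    mul_pos (sub_pos.2 hgt) (by linarith : 0 < s + D)]

theorem conditions_of_splitting {v b : ℝ} (hv : v ≠ 0) {b₁ b₂ : ℂ} {p q a e d x : ℝ}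
    (hx : x ≠ 0) (hc : p ≠ 0 ∨ q ≠ 0) (hd : 0 < d)
    (hP : ∀ z : ℝ, diagonalForm b₁ x z + diagonalForm b₂ x z + b ^ 2 * x ^ 2 + 2 * v ^ 2 * z ^ 2 =
      2 * ((x * p + z * q) ^ 2 + (a * x ^ 2 + 2 * e * x * z + d * z ^ 2)))
    (hD : ∀ z : ℝ, (diagonalForm b₁ x z + diagonalForm b₂ x z + b ^ 2 * x ^ 2) ^ 2 -
      4 * (diagonalForm b₁ x z * diagonalForm b₂ x z) =
      16 * (x * p + z * q) ^ 2 * (a * x ^ 2 + 2 * e * x * z + d * z ^ 2)) :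
    b ≠ 0 ∧ Complex.normSq b₁ = Complex.normSq b₂ ∧
      v ^ 2 * b ^ 2 = (b₁.im - b₂.im) ^ 2 := by
  have hn₁ : b₁.im ^ 2 ≤ Complex.normSq b₁ := by
    rw [Complex.normSq_apply]; nlinarith [sq_nonneg b₁.re]
  have hn₂ : b₂.im ^ 2 ≤ Complex.normSq b₂ := by
    rw [Complex.normSq_apply]; nlinarith [sq_nonneg b₂.re]
  simp only [diagonalForm] at hP hD
  generalize Complex.normSq b₁ = n₁ at *
  generalize Complex.normSq b₂ = n₂ at *
  generalize b₁.im = η₁ at *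
  generalize b₂.im = η₂ at *
  have hq : q = 0 := by
    have : q ^ 2 * d = 0 := by
      -- Central differences in z extract coefficients, here that of z⁴, which cancels on the left
      -- since both diagonal forms are monic in z; 384 = 4! · 16.
      linear_combination (-1 / 384) * (hD 2 - 4 * hD 1 + 6 * hD 0 - 4 * hD (-1) + hD (-2))
    simpa [hd.ne'] using this
  subst hq
  have hp : p ≠ 0 := by simpa using hc
  have hx2 : x ^ 2 ≠ 0 := pow_ne_zero 2 hx
  have hdv : d = 1 + v ^ 2 := by
    linear_combination (-1 / 4) * (hP 1 + hP (-1) - 2 * hP 0)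
  have hes : 2 * e = η₁ + η₂ := by
    apply mul_left_cancel₀ hx
    linear_combination (-1 / 4) * (hP 1 - hP (-1))
  have has : n₁ + n₂ + b ^ 2 = 2 * (p ^ 2 + a) := by
    apply mul_left_cancel₀ hx2
    linear_combination hP 0
  have hK : 0 < 4 * p ^ 2 := by positivity
  have hyy : (η₁ - η₂) ^ 2 + b ^ 2 = 4 * p ^ 2 * (1 + v ^ 2) := by
    rw [← hdv]
    apply mul_left_cancel₀ hx2
    linear_combination (1 / 8) * (hD 1 + hD (-1) - 2 * hD 0)
  have hxy : (n₁ - n₂) * (η₁ - η₂) = (4 * p ^ 2 - b ^ 2) * (η₁ + η₂) := by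
    have : (n₁ - n₂) * (η₁ - η₂) + b ^ 2 * (η₁ + η₂) = 4 * p ^ 2 * (2 * e) := by
      apply mul_left_cancel₀ (pow_ne_zero 3 hx)
      linear_combination (1 / 8) * (hD 1 - hD (-1))
    rw [hes] at this
    linarith
  have hxx : (n₁ - n₂) ^ 2 =
      2 * (n₁ + n₂) * (4 * p ^ 2 - b ^ 2) - (4 * p ^ 2 - b ^ 2) ^ 2 := by
    have : (n₁ - n₂) ^ 2 + b ^ 2 * (2 * (n₁ + n₂) + b ^ 2) = 16 * p ^ 2 * a := by
      apply mul_left_cancel₀ (pow_ne_zero 4 hx)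
      linear_combination hD 0
    linear_combination this - 8 * p ^ 2 * has
  have hKb := eq_sq_of_coeff_identities hv hK hn₁ hn₂ hyy hxy hxx
  refine ⟨?_, ?_, ?_⟩
  · rintro rfl
    rw [hKb] at hK
    norm_num at hK
  · rw [hKb] at hxx
    have : (n₁ - n₂) ^ 2 = 0 := by rw [hxx]; ring
    exact sub_eq_zero.1 (pow_eq_zero_iff two_ne_zero |>.1 this)
  · rw [hKb] at hyy
    linarith

/-! ### Necessity of the conditions. -/

theorem exists_support_lt {S T : Set ℂ} {f g : ℝ → ℝ → ℝ} (hT : IsCompact (convexHull ℝ T))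
    (hf : ∀ x y, IsGreatest (planeFunctional x y '' S) (f x y))
    (hg : ∀ x y, IsGreatest (planeFunctional x y '' T) (g x y))
    (h : ¬ S ⊆ convexHull ℝ T) : ∃ x y, g x y < f x y := by
  by_contra! hle
  refine h (subset_of_planeFunctional_le (convex_convexHull ℝ T) hT.isClosed fun x y w hw => ?_)
  obtain ⟨k, hk, hkm⟩ := (hg x y).planeFunctional_convexHull.1
  refine ⟨k, hk, ?_⟩
  rw [hkm]
  exact ((hf x y).2 ⟨w, hw, rfl⟩).trans (hle x y)

/-- A nonempty open condition on the plane holds at infinitely many points of some vertical line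
off the origin. -/
theorem exists_infinite_vertical {f g : ℝ → ℝ → ℝ} (hf : Continuous fun p : ℝ × ℝ => f p.1 p.2)
    (hg : Continuous fun p : ℝ × ℝ => g p.1 p.2) (h : ∃ x y, g x y < f x y) :
    ∃ x, x ≠ 0 ∧ {z | g x z < f x z}.Infinite := by
  obtain ⟨x₀, y, hxy⟩ := h
  have hopen : IsOpen {x | g x y < f x y} :=
    isOpen_lt (hg.comp (by fun_prop : Continuous fun x : ℝ => (x, y)))
      (hf.comp (by fun_prop : Continuous fun x : ℝ => (x, y)))
  have hinf : {x | g x y < f x y}.Infinite := infinite_of_mem_nhds x₀ (hopen.mem_nhds hxy)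
  -- Moving x first avoids x = 0, where the coefficient comparison would lose its information.
  obtain ⟨x, hx, hx0⟩ := (hinf.sdiff (Set.finite_singleton 0)).nonempty
  have hopen' : IsOpen {z | g x z < f x z} :=
    isOpen_lt (hg.comp (by fun_prop : Continuous fun z : ℝ => (x, z)))
      (hf.comp (by fun_prop : Continuous fun z : ℝ => (x, z)))
  exact ⟨x, hx0, infinite_of_mem_nhds y (hopen'.mem_nhds hx)⟩

theorem isGreatest_planeFunctional_union {S T : Set ℂ} {x y m k : ℝ}
    (hS : IsGreatest (planeFunctional x y '' S) m) (hT : IsGreatest (planeFunctional x y '' T) k)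
    (hkm : k ≤ m) : IsGreatest (planeFunctional x y '' convexHull ℝ (S ∪ T)) m := by
  apply IsGreatest.planeFunctional_convexHull
  rw [Set.image_union, ← max_eq_left hkm]
  exact hS.union hT

theorem kippenhahnPoly_eq_zero_of_isGreatest {v b x y m : ℝ} {b₁ b₂ : ℂ}
    (h : IsGreatest (planeFunctional x y ''
      numericalRange (triangularizedMatrix (v * Complex.I) b₁ b₂ b)) m) :
    kippenhahnPoly v b₁ b₂ b x y m = 0 := by
  have := det_eq_zero_of_isGreatest _ h
  rw [det_triangularizedMatrix] at this
  exact_mod_cast this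

theorem conditions_of_eq_convexHull {v b : ℝ} (hv : v ≠ 0) {b₁ b₂ c₁ c₂ : ℂ} {E₁ E₂ : Set ℂ}
    (h₁ : IsEllipse E₁ c₁) (h₂ : IsEllipse E₂ c₂) (hc : c₁ ≠ 0)
    (hsub : ¬ E₁ ⊆ convexHull ℝ E₂)
    (hW : numericalRange (triangularizedMatrix (v * Complex.I) b₁ b₂ b) =
      convexHull ℝ (E₁ ∪ E₂)) :
    b ≠ 0 ∧ Complex.normSq b₁ = Complex.normSq b₂ ∧
      v ^ 2 * b ^ 2 = (b₁.im - b₂.im) ^ 2 := by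
  obtain ⟨a, e, d, ha, hd, hdisc, hE₁⟩ := h₁.exists_support
  obtain ⟨a', e', d', -, -, -, hE₂⟩ := h₂.exists_support
  obtain ⟨x, hx, hinf⟩ := exists_infinite_vertical (by fun_prop) (by fun_prop)
    (exists_support_lt h₂.isCompact_convexHull hE₁ hE₂ hsub)
  have hc' : c₁.re ≠ 0 ∨ c₁.im ≠ 0 := by
    by_contra! h
    exact hc (Complex.ext h.1 h.2)
  obtain ⟨hP, hD⟩ := splitting_of_infinite_roots (v := v) (b := b) (b₁ := b₁) (b₂ := b₂)
    hx hc' hd hdisc (hinf.mono fun z hz => by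
      apply kippenhahnPoly_eq_zero_of_isGreatest
      rw [hW]
      exact isGreatest_planeFunctional_union (hE₁ x z) (hE₂ x z) (le_of_lt hz))
  exact conditions_of_splitting hv hx hc' hd hP hD

/-! ### Sufficiency of the conditions. -/

/-- The Kippenhahn polynomial splits into quadratics belonging to two congruent ellipses. -/
theorem kippenhahnPoly_eq_mul {v b n x y t : ℝ} {b₁ b₂ : ℂ} (h₁ : Complex.normSq b₁ = n)
    (h₂ : Complex.normSq b₂ = n) (hvb : v ^ 2 * b ^ 2 = (b₁.im - b₂.im) ^ 2) :
    kippenhahnPoly v b₁ b₂ b x y t =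
      ((t - x * (b / 2)) ^ 2 - ((n + b ^ 2 / 4) * x ^ 2 + 2 * ((b₁.im + b₂.im) / 2) * x * y +
        (1 + v ^ 2) * y ^ 2)) *
      ((t + x * (b / 2)) ^ 2 - ((n + b ^ 2 / 4) * x ^ 2 + 2 * ((b₁.im + b₂.im) / 2) * x * y +
        (1 + v ^ 2) * y ^ 2)) := by
  simp only [kippenhahnPoly, diagonalForm, h₁, h₂]
  -- The two sides differ only in the coefficient of x²y².
  linear_combination (x ^ 2 * y ^ 2) * hvb

theorem isBiElliptical_of_conditions {v b : ℝ} {b₁ b₂ : ℂ} (hb : 0 < b)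
    (hn : Complex.normSq b₁ = Complex.normSq b₂)
    (hvb : v ^ 2 * b ^ 2 = (b₁.im - b₂.im) ^ 2) :
    IsBiElliptical (numericalRange (triangularizedMatrix (v * Complex.I) b₁ b₂ b)) := by
  set W := numericalRange (triangularizedMatrix (v * Complex.I) b₁ b₂ b) with hWdef
  have hn₁ : b₁.im ^ 2 ≤ Complex.normSq b₁ := by
    rw [Complex.normSq_apply]; nlinarith [sq_nonneg b₁.re]
  have hn₂ : b₂.im ^ 2 ≤ Complex.normSq b₁ := by
    rw [hn, Complex.normSq_apply]; nlinarith [sq_nonneg b₂.re]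
  have hF := fun x y t => kippenhahnPoly_eq_mul (x := x) (y := y) (t := t) rfl hn.symm hvb
  set n := Complex.normSq b₁ with hndef
  have hn0 : 0 ≤ n := Complex.normSq_nonneg _
  have ha : 0 < n + b ^ 2 / 4 := by positivity
  -- The squared mean of the imaginary parts is at most n; b > 0 makes the inequality strict, so the
  -- ellipses are non-degenerate.
  have hdisc : ((b₁.im + b₂.im) / 2) ^ 2 < (n + b ^ 2 / 4) * (1 + v ^ 2) := by
    have h1 : ((b₁.im + b₂.im) / 2) ^ 2 ≤ n := by nlinarith [sq_nonneg (b₁.im - b₂.im)]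
    have h2 : n + b ^ 2 / 4 ≤ (n + b ^ 2 / 4) * (1 + v ^ 2) := by nlinarith [sq_nonneg v]
    have h3 : 0 < b ^ 2 / 4 := by positivity
    linarith
  obtain ⟨E, hE⟩ := exists_isEllipse_support (n + b ^ 2 / 4) ((b₁.im + b₂.im) / 2) (1 + v ^ 2)
    ha hdisc
  set Q : ℝ → ℝ → ℝ := fun x y => (n + b ^ 2 / 4) * x ^ 2 +
    2 * ((b₁.im + b₂.im) / 2) * x * y + (1 + v ^ 2) * y ^ 2 with hQ
  have hQ0 : ∀ x y, 0 ≤ Q x y := by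
    intro x y
    have hd : 0 < 1 + v ^ 2 := by positivity
    rcases eq_or_ne x 0 with rfl | hx
    · simp only [hQ]; nlinarith [mul_nonneg hd.le (sq_nonneg y)]
    · exact (quadraticForm_pos hd hdisc hx).le
  have hc₁ : ∀ x y : ℝ, IsGreatest (planeFunctional x y '' E ((b / 2 : ℝ) : ℂ))
      (x * (b / 2) + Real.sqrt (Q x y)) := fun x y => by
    simpa [-Complex.ofReal_div] using (hE ((b / 2 : ℝ) : ℂ)).2 x y
  have hc₂ : ∀ x y : ℝ, IsGreatest (planeFunctional x y '' E ((-(b / 2) : ℝ) : ℂ))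
      (-(x * (b / 2)) + Real.sqrt (Q x y)) := fun x y => by
    simpa [-Complex.ofReal_div, -Complex.ofReal_neg] using (hE ((-(b / 2) : ℝ) : ℂ)).2 x y
  have he₁ := (hE ((b / 2 : ℝ) : ℂ)).1
  have he₂ := (hE ((-(b / 2) : ℝ) : ℂ)).1
  have hattain : ∀ x y t, (t - x * (b / 2)) ^ 2 = Q x y ∨ (t + x * (b / 2)) ^ 2 = Q x y →
      ∃ w ∈ W, planeFunctional x y w = t := by
    intro x y t ht
    apply exists_planeFunctional_eq_of_det_eq_zero
    rw [det_triangularizedMatrix, hF, Complex.ofReal_eq_zero, mul_eq_zero, sub_eq_zero,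
      sub_eq_zero]
    exact ht
  refine ⟨E ((b / 2 : ℝ) : ℂ), E ((-(b / 2) : ℝ) : ℂ), _, _, he₁, he₂, ?_, ?_, ?_, ?_⟩
  · intro h
    have := Complex.ofReal_injective h
    linarith
  · intro h
    obtain ⟨w, hw, hwm⟩ := (hc₁ 1 0).1
    have := (hc₂ 1 0).planeFunctional_convexHull.2 ⟨w, h hw, rfl⟩
    rw [hwm] at this
    linarith
  · intro h
    obtain ⟨w, hw, hwm⟩ := (hc₂ (-1) 0).1
    have := (hc₁ (-1) 0).planeFunctional_convexHull.2 ⟨w, h hw, rfl⟩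
    rw [hwm] at this
    linarith
  · apply Set.Subset.antisymm
    · refine subset_of_planeFunctional_le (convex_convexHull ℝ _)
        (isCompact_convexHull_union he₁.isCompact_convexHull he₂.isCompact_convexHull
          he₁.nonempty he₂.nonempty).isClosed fun x y w hw => ?_
      obtain ⟨m, hm⟩ := ((isCompact_numericalRange
        (triangularizedMatrix (v * Complex.I) b₁ b₂ b)).image
        (continuous_planeFunctional x y)).exists_isGreatest ((nonempty_numericalRange _).image _)
      have hwm : planeFunctional x y w ≤ m := hm.2 ⟨w, hw, rfl⟩
      have hroot := kippenhahnPoly_eq_zero_of_isGreatest hm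
      rw [hF] at hroot
      rcases mul_eq_zero.1 hroot with h | h
      · obtain ⟨k, hk, hkm⟩ := (hc₁ x y).1
        refine ⟨k, subset_convexHull ℝ _ (Or.inl hk), ?_⟩
        have := Real.le_sqrt_of_sq_le (sub_eq_zero.1 h).le
        rw [hkm]
        linarith
      · obtain ⟨k, hk, hkm⟩ := (hc₂ x y).1
        refine ⟨k, subset_convexHull ℝ _ (Or.inr hk), ?_⟩
        have := Real.le_sqrt_of_sq_le (sub_eq_zero.1 h).le
        rw [hkm]
        linarith
    · refine convexHull_min ?_ (convex_numericalRange _)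
      refine subset_of_planeFunctional_le (convex_numericalRange _)
        (isCompact_numericalRange _).isClosed fun x y w hw => ?_
      rcases hw with hw | hw
      · obtain ⟨k, hk, hkt⟩ := hattain x y _ (Or.inl (by
          rw [add_sub_cancel_left]; exact Real.sq_sqrt (hQ0 x y)))
        exact ⟨k, hk, hkt ▸ (hc₁ x y).2 ⟨w, hw, rfl⟩⟩
      · obtain ⟨k, hk, hkt⟩ := hattain x y (-(x * (b / 2)) + Real.sqrt (Q x y)) (Or.inr (by
          rw [neg_add_eq_sub, sub_add_cancel]; exact Real.sq_sqrt (hQ0 x y)))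
        exact ⟨k, hk, hkt ▸ (hc₂ x y).2 ⟨w, hw, rfl⟩⟩

theorem theorem4p4 (v : ℝ) (hv : v ≠ 0) (b₁ b₂ : ℂ) (b : ℝ) (hb : 0 ≤ b) :
    IsBiElliptical (numericalRange (triangularizedMatrix (v * Complex.I) b₁ b₂ b)) ↔
      b ≠ 0 ∧ ‖b₁‖ = ‖b₂‖ ∧ v ^ 2 * b ^ 2 = (b₁.im - b₂.im) ^ 2 := by
  have hnorm : Complex.normSq b₁ = Complex.normSq b₂ ↔ ‖b₁‖ = ‖b₂‖ := by
    rw [Complex.normSq_eq_norm_sq, Complex.normSq_eq_norm_sq,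
      pow_left_inj₀ (norm_nonneg _) (norm_nonneg _) two_ne_zero]
  rw [← hnorm]
  constructor
  · rintro ⟨E₁, E₂, c₁, c₂, h₁, h₂, hc, h₁₂, h₂₁, hW⟩
    rcases eq_or_ne c₁ 0 with rfl | hc₁
    · rw [Set.union_comm] at hW
      exact conditions_of_eq_convexHull hv h₂ h₁ hc.symm h₂₁ hW
    · exact conditions_of_eq_convexHull hv h₁ h₂ hc₁ h₁₂ hW
  · rintro ⟨hb0, hn, hvb⟩
    exact isBiElliptical_of_conditions (lt_of_le_of_ne hb hb0.symm) hn hvb
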